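/- Let $\Sigma$ be an alphabet (a possibly infinite set). *Pomsets.* A labelled poset over $\Sigma$ is a finite set $S$ with a partial order $\le$ and a labelling $\lambda : S \to \Sigma$; a pomset is an isomorphism class of labelled posets (under label-preserving order isomorphisms). Write $1$ for the empty pomset and $\mathtt a$ for the one-node pomset with label $\mathtt a$. The parallel composition $U \parallel V$ is the disjoint union with no order between the two parts; the sequential composition $U \cdot V$ is the disjoint union in which additionally every node of $U$ is below every node of $V$. The set $\mathsf{SP}$ of series-parallel pomsets is the smallest set of pomsets that contains $1$ and all $\mathtt a$ ($\mathtt a\in\Sigma$) and is closed under $\cdot$ and $\parallel$. We write $U \sqsubseteq V$ ($U$ is subsumed by $V$) if there is a label- and order-preserving bijection from the nodes of $V$ to the nodes of $U$, and $\sqsubseteq^{\mathsf{sp}}$ for the restriction of $\sqsubseteq$ to $\mathsf{SP}$. *Contexts.* A series-parallel context $C \in \mathsf{PC}^{\mathsf{sp}}$ is a series-parallel pomset over $\Sigma \cup \{*\}$, where $* \notin \Sigma$, with exactly one node $s_*$ labelled $*$. For a pomset $U$, the pomset $C[U]$ is obtained by replacing $s_*$ with $U$: nodes of $C$ other than $s_*$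 keep their order, nodes of $U$ keep theirs, and a node $s \ne s_*$ of $C$ is below (above) every node of $U$ iff $s$ is below (above) $s_*$ in $C$. For a set $K$ of pomsets, $C[K] = \{C[U] : U \in K\}$. *Terms and closure.* Terms are generated by $e,f ::= 0 \mid 1 \mid \mathtt a \in \Sigma \mid e+f \mid e\cdot f \mid e \parallel f \mid e^*$, with $[\![0]\!]=\emptyset$, $[\![1]\!]=\{1\}$, $[\![\mathtt a]\!]=\{\mathtt a\}$, $[\![e+f]\!]=[\![e]\!]\cup[\![f]\!]$, the operators $\cdot$ and $\parallel$ interpreted elementwise on sets of pomsets, and $[\![e^*]\!]=\bigcup_{n\in\mathbb N}[\![e]\!]^n$, where $K^0=\{1\}$ and $K^{n+1}=K^n\cdot K$. For a set $H$ of hypotheses $e\le f$ (pairs of terms) and a set $L$ of pomsets, the $H$-closure of $L$ is the smallest set $L'$ of pomsets with $L\subseteq L'$ such that, for all $e \le f$ in $H$ and all $C\in\mathsf{PC}^{\mathsf{sp}}$, $C[[\![f]\!]]\subseteq L'$ implies $C[[\![e]\!]]\subseteq L'$. Let $$\mathsf{exch}=\{(e\parallel f)\cdot(g\parallel h)\le(e\cdot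 g)\parallel(f\cdot h) : e,f,g,h \text{ terms}\}.$$ **Lemma.** Let $L\subseteq\mathsf{SP}$. For every $U\in\mathsf{SP}$, $U$ lies in the $\mathsf{exch}$-closure of $L$ if and only if there exists $V\in L$ with $U\sqsubseteq^{\mathsf{sp}}V$. Moreover, the $\mathsf{exch}$-closure of $L$ is exactly the downward closure $\{U : \exists V\in L,\ U\sqsubseteq^{\mathsf{sp}}V\}$ of $L$ under $\sqsubseteq^{\mathsf{sp}}$. -/

import Mathlib

namespace CKA

universe u

/-- A labelled poset over the alphabet `A`: a finite carrier with a partial order and a labelling.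
Pomsets are isomorphism classes of these, so it does not matter that carriers are arbitrary finite
types rather than finite subsets of a fixed countably infinite set. -/
structure LPoset (A : Type u) where
  carrier : Type
  finite : Finite carrier
  order : PartialOrder carrier
  label : carrier → A

attribute [instance] LPoset.finite LPoset.order

namespace LPoset

variable {A : Type u}

/-- Isomorphism: a bijection that preserves labels and preserves and reflects the order. -/
def Iso (x y : LPoset A) : Prop :=
  ∃ h : x.carrier ≃o y.carrier, ∀ s, y.label (h s) = x.label s

theorem Iso.refl (x : LPoset A) : Iso x x := ⟨OrderIso.refl _, fun _ => rfl⟩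

theorem Iso.symm {x y : LPoset A} : Iso x y → Iso y x := by
  rintro ⟨h, hl⟩
  exact ⟨h.symm, fun s => by rw [← hl, h.apply_symm_apply]⟩

theorem Iso.trans {x y z : LPoset A} : Iso x y → Iso y z → Iso x z := by
  rintro ⟨h, hl⟩ ⟨k, kl⟩
  exact ⟨h.trans k, fun s => by rw [OrderIso.trans_apply, kl, hl]⟩

instance setoid (A : Type u) : Setoid (LPoset A) := ⟨Iso, Iso.refl, Iso.symm, Iso.trans⟩

/-- The empty labelled poset. -/
def empty (A : Type u) : LPoset A :=
  ⟨Empty, inferInstance, inferInstance, Empty.elim⟩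

/-- The one-element labelled poset with label `a`. -/
def letter (a : A) : LPoset A :=
  ⟨Unit, inferInstance, inferInstance, fun _ => a⟩

/-- Parallel composition: disjoint union, with no order between the two parts. -/
def par (x y : LPoset A) : LPoset A :=
  ⟨x.carrier ⊕ y.carrier, inferInstance, inferInstance, Sum.elim x.label y.label⟩

/-- Sequential composition: disjoint union, with everything on the left below everything on the
right (the lexicographic sum). -/
def seq (x y : LPoset A) : LPoset A :=
  ⟨x.carrier ⊕ₗ y.carrier, inferInstanceAs (Finite (x.carrier ⊕ y.carrier)), inferInstance,
    fun s => Sum.elim x.label y.label (ofLex s)⟩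

/-- `x` is subsumed by `y`: there is a label- and order-preserving bijection from the carrier of
`y` to the carrier of `x`. -/
def Subsumed (x y : LPoset A) : Prop :=
  ∃ h : y.carrier → x.carrier, Function.Bijective h ∧ (∀ s, x.label (h s) = y.label s) ∧
    ∀ s t, s ≤ t → h s ≤ h t

/-- A labelled poset over `Option A`, i.e. over the alphabet with the extra symbol `* = none`,
represents a context if it has exactly one node labelled `*`. -/
def IsContext (c : LPoset (Option A)) : Prop := ∃! s, c.label s = none

/-- The order of `c[x]`, on the nodes of `c` not labelled `*` together with the nodes of `x`.
It is only ever used when `c` has exactly one node `s⋆` labelled `*`; then the third and fourth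
clauses say `s ≤ s⋆` and `s⋆ ≤ t`, see `plugLE_inl_inr` and `plugLE_inr_inl`. (The choice of `∃`
in one and `∀` in the other makes this a partial order for every `c`.) -/
def plugLE (c : LPoset (Option A)) (x : LPoset A) :
    {s : c.carrier // c.label s ≠ none} ⊕ x.carrier →
    {s : c.carrier // c.label s ≠ none} ⊕ x.carrier → Prop
  | .inl s, .inl t => s.1 ≤ t.1
  | .inr s, .inr t => s ≤ t
  | .inl s, .inr _ => ∃ p, c.label p = none ∧ s.1 ≤ p
  | .inr _, .inl t => ∀ p, c.label p = none → p ≤ t.1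

theorem plugLE_inl_inr {c : LPoset (Option A)} (x : LPoset A) (hc : c.IsContext)
    {p : c.carrier} (hp : c.label p = none) (s : {s : c.carrier // c.label s ≠ none})
    (t : x.carrier) : plugLE c x (.inl s) (.inr t) ↔ s.1 ≤ p :=
  ⟨fun ⟨_, hq, h⟩ => hc.unique hq hp ▸ h, fun h => ⟨p, hp, h⟩⟩

theorem plugLE_inr_inl {c : LPoset (Option A)} (x : LPoset A) (hc : c.IsContext)
    {p : c.carrier} (hp : c.label p = none) (t : {s : c.carrier // c.label s ≠ none})
    (s : x.carrier) : plugLE c x (.inr s) (.inl t) ↔ p ≤ t.1 :=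
  ⟨fun h => h p hp, fun h _ hq => hc.unique hp hq ▸ h⟩

/-- The partial order on the carrier of `c[x]`. -/
@[reducible] def plugOrder (c : LPoset (Option A)) (x : LPoset A) :
    PartialOrder ({s : c.carrier // c.label s ≠ none} ⊕ x.carrier) where
  le := plugLE c x
  lt s t := plugLE c x s t ∧ ¬ plugLE c x t s
  lt_iff_le_not_ge _ _ := Iff.rfl
  le_refl s := by rcases s with s | s <;> exact le_refl _
  le_trans := by
    rintro (⟨r, hr⟩ | r) (⟨s, hs⟩ | s) (⟨t, ht⟩ | t) h k
    · exact le_trans (α := c.carrier) h k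
    · obtain ⟨p, hp, hsp⟩ := k
      exact ⟨p, hp, le_trans (α := c.carrier) h hsp⟩
    · obtain ⟨p, hp, hrp⟩ := h
      exact le_trans (α := c.carrier) hrp (k p hp)
    · exact h
    · exact fun p hp => le_trans (α := c.carrier) (h p hp) k
    · obtain ⟨p, hp, hsp⟩ := k
      exact absurd ((congrArg c.label (le_antisymm hsp (h p hp))).trans hp) hs
    · exact k
    · exact le_trans (α := x.carrier) h k
  le_antisymm := by
    rintro (⟨s, hs⟩ | s) (⟨t, ht⟩ | t) h k
    · exact congrArg Sum.inl (Subtype.ext (le_antisymm (α := c.carrier) h k))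
    · obtain ⟨p, hp, hsp⟩ := h
      exact absurd ((congrArg c.label (le_antisymm hsp (k p hp))).trans hp) hs
    · obtain ⟨p, hp, htp⟩ := k
      exact absurd ((congrArg c.label (le_antisymm htp (h p hp))).trans hp) ht
    · exact congrArg Sum.inr (le_antisymm (α := x.carrier) h k)

/-- `c[x]`: the node of `c` labelled `*` is replaced by `x`. -/
def plug (c : LPoset (Option A)) (x : LPoset A) : LPoset A where
  carrier := {s : c.carrier // c.label s ≠ none} ⊕ x.carrier
  finite := inferInstance
  order := plugOrder c x
  label := Sum.elim
    (fun s => (c.label s.1).get (Option.isSome_iff_ne_none.mpr s.2)) x.label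

theorem par_iso {x x' y y' : LPoset A} : Iso x x' → Iso y y' → Iso (par x y) (par x' y') := by
  rintro ⟨h, hl⟩ ⟨k, kl⟩
  refine ⟨OrderIso.sumCongr h k, ?_⟩
  rintro (s | s)
  · exact hl s
  · exact kl s

theorem seq_iso {x x' y y' : LPoset A} : Iso x x' → Iso y y' → Iso (seq x y) (seq x' y') := by
  rintro ⟨h, hl⟩ ⟨k, kl⟩
  refine ⟨OrderIso.sumLexCongr h k, ?_⟩
  rintro (s | s)
  · exact hl s
  · exact kl s

theorem Subsumed.of_iso {x x' y y' : LPoset A} (hx : Iso x x') (hy : Iso y y')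
    (h : Subsumed x y) : Subsumed x' y' := by
  obtain ⟨i, il⟩ := hx
  obtain ⟨j, jl⟩ := hy.symm
  obtain ⟨h, hb, hl, hm⟩ := h
  refine ⟨i ∘ h ∘ j, i.bijective.comp (hb.comp j.bijective), fun s => ?_, fun s t hst => ?_⟩
  · rw [Function.comp_apply, il, Function.comp_apply, hl, jl]
  · exact i.monotone (hm _ _ (j.monotone hst))

theorem IsContext.of_iso {c d : LPoset (Option A)} (h : Iso c d) (hc : c.IsContext) :
    d.IsContext := by
  obtain ⟨h, hl⟩ := h
  obtain ⟨s, hs, hu⟩ := hc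
  refine ⟨h s, (hl s).trans hs, fun t ht => ?_⟩
  rw [← hu (h.symm t) (by
    change c.label (h.symm t) = none
    rw [← hl, h.apply_symm_apply]; exact ht), h.apply_symm_apply]

theorem plug_iso {c d : LPoset (Option A)} {x y : LPoset A} :
    Iso c d → Iso x y → Iso (plug c x) (plug d y) := by
  rintro ⟨h, hl⟩ ⟨k, kl⟩
  let e : {s : c.carrier // c.label s ≠ none} ≃ {s : d.carrier // d.label s ≠ none} :=
    h.toEquiv.subtypeEquiv (fun s => by
      change c.label s ≠ none ↔ d.label (h s) ≠ none
      rw [hl])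
  refine ⟨⟨Equiv.sumCongr e k.toEquiv, ?_⟩, ?_⟩
  · rintro (s | s) (t | t)
    · exact h.le_iff_le
    · constructor
      · rintro ⟨p, hp, hsp⟩
        exact ⟨h.symm p, by rw [← hl, h.apply_symm_apply]; exact hp,
          h.le_symm_apply.mpr hsp⟩
      · rintro ⟨p, hp, hsp⟩
        exact ⟨h p, by rw [hl]; exact hp, h.monotone hsp⟩
    · constructor
      · intro H p hp
        exact h.le_iff_le.mp (H (h p) (by rw [hl]; exact hp))
      · intro H p hp
        exact h.symm_apply_le.mp (H (h.symm p) (by rw [← hl, h.apply_symm_apply]; exact hp))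
    · exact k.le_iff_le
  · rintro (s | s)
    · apply Option.some_injective
      change some (Option.get _ _) = some (Option.get _ _)
      rw [Option.some_get, Option.some_get]
      exact hl s.1
    · exact kl s

end LPoset

/-- Pomsets over `A`: isomorphism classes of labelled posets. -/
def Pomset (A : Type u) : Type (max 1 u) := Quotient (LPoset.setoid A)

namespace Pomset

variable {A : Type u}

/-- The empty pomset `1`. -/
def one : Pomset A := Quotient.mk _ (LPoset.empty A)

/-- The one-letter pomset. -/
def letter (a : A) : Pomset A := Quotient.mk _ (LPoset.letter a)

/-- Parallel composition `U ∥ V`. -/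
def par : Pomset A → Pomset A → Pomset A :=
  Quotient.map₂ LPoset.par fun _ _ h _ _ k => LPoset.par_iso h k

/-- Sequential composition `U · V`. -/
def seq : Pomset A → Pomset A → Pomset A :=
  Quotient.map₂ LPoset.seq fun _ _ h _ _ k => LPoset.seq_iso h k

/-- `U ⊑ V`: `U` is subsumed by `V`. -/
def Subsumed : Pomset A → Pomset A → Prop :=
  Quotient.lift₂ LPoset.Subsumed fun _ _ _ _ h k => propext
    ⟨LPoset.Subsumed.of_iso h k, LPoset.Subsumed.of_iso (LPoset.Iso.symm h) (LPoset.Iso.symm k)⟩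

/-- Series-parallel pomsets. -/
inductive IsSP : Pomset A → Prop
  | one : IsSP one
  | letter (a : A) : IsSP (letter a)
  | par {U V : Pomset A} : IsSP U → IsSP V → IsSP (par U V)
  | seq {U V : Pomset A} : IsSP U → IsSP V → IsSP (seq U V)

/-- `U ⊑ˢᵖ V`: the restriction of subsumption to series-parallel pomsets. -/
def SubsumedSP (U V : Pomset A) : Prop := IsSP U ∧ IsSP V ∧ Subsumed U V

/-- Pomset contexts: pomsets over `A ∪ {*}` with exactly one node labelled `* = none`. -/
def IsContext : Pomset (Option A) → Prop :=
  Quotient.lift LPoset.IsContext fun _ _ h => propext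
    ⟨LPoset.IsContext.of_iso h, LPoset.IsContext.of_iso (LPoset.Iso.symm h)⟩

/-- `C[U]`: plugging the pomset `U` into the gap of the context `C`. -/
def plug : Pomset (Option A) → Pomset A → Pomset A :=
  Quotient.map₂ LPoset.plug fun _ _ h _ _ k => LPoset.plug_iso h k

end Pomset

/-- The set `SP` of series-parallel pomsets. -/
def SP (A : Type u) : Set (Pomset A) := {U | U.IsSP}

/-- The set `PCˢᵖ` of series-parallel pomset contexts. -/
def PCSP (A : Type u) : Set (Pomset (Option A)) := {C | C.IsContext ∧ C.IsSP}

/-- Concurrent Kleene algebra terms over the alphabet `A`. -/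
inductive Term (A : Type u) : Type u
  | zero : Term A
  | one : Term A
  | letter : A → Term A
  | add : Term A → Term A → Term A
  | seq : Term A → Term A → Term A
  | par : Term A → Term A → Term A
  | star : Term A → Term A

/-- Powers of a pomset language. -/
def langPow {A : Type u} (L : Set (Pomset A)) : ℕ → Set (Pomset A)
  | 0 => {Pomset.one}
  | n + 1 => Set.image2 Pomset.seq (langPow L n) L

/-- The pomset language `⟦e⟧` of a term. -/
def Term.sem {A : Type u} : Term A → Set (Pomset A)
  | .zero => ∅
  | .one => {Pomset.one}
  | .letter a => {Pomset.letter a}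
  | .add e f => e.sem ∪ f.sem
  | .seq e f => Set.image2 Pomset.seq e.sem f.sem
  | .par e f => Set.image2 Pomset.par e.sem f.sem
  | .star e => ⋃ n : ℕ, langPow e.sem n

/-- A hypothesis `e ≤ f`. -/
structure Hypothesis (A : Type u) where
  lhs : Term A
  rhs : Term A

/-- `C[L] = {C[U] : U ∈ L}`. -/
def plugLang {A : Type u} (C : Pomset (Option A)) (L : Set (Pomset A)) : Set (Pomset A) :=
  C.plug '' L

/-- Membership in the `H`-closure of `L`: the smallest language containing `L` such that, for all
`e ≤ f` in `H` and all series-parallel contexts `C`, if `C[⟦f⟧]` is contained in it, then so is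
`C[⟦e⟧]`. -/
inductive InClosure {A : Type u} (H : Set (Hypothesis A)) (L : Set (Pomset A)) : Pomset A → Prop
  | base {U : Pomset A} : U ∈ L → InClosure H L U
  | step {h : Hypothesis A} {C : Pomset (Option A)} : h ∈ H → C ∈ PCSP A →
      (∀ W ∈ plugLang C h.rhs.sem, InClosure H L W) →
      ∀ {U : Pomset A}, U ∈ plugLang C h.lhs.sem → InClosure H L U

/-- The `H`-closure of a pomset language `L`. -/
def hypClosure {A : Type u} (H : Set (Hypothesis A)) (L : Set (Pomset A)) : Set (Pomset A) :=
  {U | InClosure H L U}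

/-- The exchange law as a set of hypotheses: all `(e ∥ f) · (g ∥ h) ≤ (e · g) ∥ (f · h)`. -/
def exch (A : Type u) : Set (Hypothesis A) :=
  {k | ∃ e f g h : Term A,
    k = ⟨.seq (.par e f) (.par g h), .par (.seq e g) (.seq f h)⟩}

end CKA

/-! Soundness: an instance of exchange replaces `(U · W) ∥ (V · X)` by `(U ∥ V) · (W ∥ X)` inside a
context. The latter is subsumed by the former, plugging is monotone for subsumption, and
series-parallel contexts preserve `SP`. Induction on the closure then gives
`InClosure.exists_subsumedSP`.

Completeness: subsumption on `SP` is generated by exchange (`exchLE_of_subsumed`), by strong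
induction on the number of nodes. Let `x ⊑ y`, so that `y` carries less order. If `x = x₁ ∥ x₂`,
then `y` splits in parallel along the same nodes. If `y = y₁ · y₂`, then `x` splits sequentially
along the same nodes. The remaining case is `x = x₁ · x₂` and `y = y₁ ∥ y₂`. The nodes of `x₁` form
a lower set `p` of `y`, which cuts each `yᵢ` into a lower part `yᵢ'` and an upper part `yᵢ''`. Then
`x ⊑ (y₁' ∥ y₂') · (y₁'' ∥ y₂'') ⊑ (y₁' · y₁'') ∥ (y₂' · y₂'') ⊑ y₁ ∥ y₂`: the middle step is
exchange, and the outer ones hold by induction componentwise. The pieces stay in `SP` because `SP`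
is closed under induced sub-posets (`IsSP.of_embeds`).

Finally `ExchLE.inClosure` replays such a derivation in the closure, using that each series-parallel
pomset is the only element of the language of some term. -/

namespace CKA

universe u

/-! ### Restrictions, sub-posets and splittings of labelled posets. -/

namespace LPoset

variable {A : Type u}

/-- Isomorphism from an equivalence. -/
theorem Iso.of_equiv {x y : LPoset A} (e : x.carrier ≃ y.carrier)
    (hle : ∀ s t, e s ≤ e t ↔ s ≤ t) (hl : ∀ s, y.label (e s) = x.label s) : Iso x y :=
  ⟨⟨e, fun {s t} => hle s t⟩, hl⟩

/-- Subsumption from an equivalence that reflects the order. -/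
theorem Subsumed.of_equiv {x y : LPoset A} (e : x.carrier ≃ y.carrier)
    (hle : ∀ s t, e s ≤ e t → s ≤ t) (hl : ∀ s, y.label (e s) = x.label s) : Subsumed x y :=
  ⟨e.symm, e.symm.bijective, fun s => by rw [← hl, e.apply_symm_apply],
    fun s t hst => hle _ _ (by rwa [e.apply_symm_apply, e.apply_symm_apply])⟩

/-- Restriction of a labelled poset to a set of nodes. -/
def restrict (x : LPoset A) (p : x.carrier → Prop) : LPoset A :=
  ⟨{s // p s}, inferInstance, inferInstance, fun s => x.label s.1⟩

/-- A labelled poset splits in parallel along a set of nodes unrelated to its complement. -/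
theorem iso_par_restrict (x : LPoset A) (p : x.carrier → Prop)
    (h : ∀ s t, p s → ¬ p t → ¬ s ≤ t ∧ ¬ t ≤ s) :
    Iso x (par (x.restrict p) (x.restrict fun s => ¬ p s)) := by
  classical
  refine Iso.symm (Iso.of_equiv (Equiv.sumCompl p) ?_ ?_)
  · rintro (⟨s, hs⟩ | ⟨s, hs⟩) (⟨t, ht⟩ | ⟨t, ht⟩)
    · exact (Sum.inl_le_inl_iff (a := (⟨s, hs⟩ : {s // p s})) (b := ⟨t, ht⟩)).symm
    · exact iff_of_false (h s t hs ht).1 Sum.not_inl_le_inr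
    · exact iff_of_false (h t s ht hs).2 Sum.not_inr_le_inl
    · exact (Sum.inr_le_inr_iff (a := (⟨s, hs⟩ : {s // ¬ p s})) (b := ⟨t, ht⟩)).symm
  · rintro (⟨s, hs⟩ | ⟨s, hs⟩) <;> rfl

/-- Sequencing a lower set of nodes before its complement only adds order. -/
theorem seq_restrict_subsumed (x : LPoset A) (p : x.carrier → Prop)
    (h : ∀ s t, p s → ¬ p t → ¬ t ≤ s) :
    Subsumed (seq (x.restrict p) (x.restrict fun s => ¬ p s)) x := by
  classical
  refine Subsumed.of_equiv (ofLex.trans (Equiv.sumCompl p)) ?_ ?_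
  · rintro (⟨s, hs⟩ | ⟨s, hs⟩) (⟨t, ht⟩ | ⟨t, ht⟩) hst
    · exact Sum.Lex.inl_le_inl_iff.mpr hst
    · exact Sum.Lex.inl_le_inr _ _
    · exact absurd hst (h t s ht hs)
    · exact Sum.Lex.inr_le_inr_iff.mpr hst
  · rintro (⟨s, hs⟩ | ⟨s, hs⟩) <;> rfl

/-- A labelled poset splits sequentially along a set of nodes below its complement. -/
theorem iso_seq_restrict (x : LPoset A) (p : x.carrier → Prop)
    (h : ∀ s t, p s → ¬ p t → s ≤ t) :
    Iso x (seq (x.restrict p) (x.restrict fun s => ¬ p s)) := by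
  classical
  refine Iso.symm (Iso.of_equiv (ofLex.trans (Equiv.sumCompl p)) ?_ ?_)
  · rintro (⟨s, hs⟩ | ⟨s, hs⟩) (⟨t, ht⟩ | ⟨t, ht⟩)
    · exact (Sum.Lex.inl_le_inl_iff (a := (⟨s, hs⟩ : {s // p s})) (b := ⟨t, ht⟩)).symm
    · exact iff_of_true (h s t hs ht) (Sum.Lex.inl_le_inr _ _)
    · refine iff_of_false (fun hst : s ≤ t => hs ?_) Sum.Lex.not_inr_le_inl
      rwa [le_antisymm hst (h t s ht hs)]
    · exact (Sum.Lex.inr_le_inr_iff (a := (⟨s, hs⟩ : {s // ¬ p s})) (b := ⟨t, ht⟩)).symm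
  · rintro (⟨s, hs⟩ | ⟨s, hs⟩) <;> rfl

/-- `z` is isomorphic to an induced sub-poset of `x`. -/
def Embeds (z x : LPoset A) : Prop :=
  ∃ f : z.carrier ↪o x.carrier, ∀ s, x.label (f s) = z.label s

theorem restrict_embeds (x : LPoset A) (p : x.carrier → Prop) : Embeds (x.restrict p) x :=
  ⟨OrderEmbedding.subtype p, fun _ => rfl⟩

theorem Embeds.trans_iso {z x y : LPoset A} : Embeds z x → Iso x y → Embeds z y := by
  rintro ⟨f, hf⟩ ⟨e, he⟩
  exact ⟨f.trans e.toOrderEmbedding, fun s => (he _).trans (hf s)⟩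

theorem iso_of_isEmpty {x y : LPoset A} (hx : IsEmpty x.carrier) (hy : IsEmpty y.carrier) :
    Iso x y :=
  Iso.of_equiv (Equiv.equivOfIsEmpty _ _) (fun s => hx.elim s) (fun s => hx.elim s)

/-- A sub-poset of a parallel composition splits in parallel. -/
theorem Embeds.par {z x y : LPoset A} (h : Embeds z (par x y)) :
    ∃ z₁ z₂, Embeds z₁ x ∧ Embeds z₂ y ∧ Iso z (LPoset.par z₁ z₂) := by
  obtain ⟨f, hf⟩ := h
  let p : z.carrier → Prop := fun s => ∃ a : x.carrier, f s = Sum.inl a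
  have hn : ∀ s, ¬ p s → ∃ b : y.carrier, f s = Sum.inr b := by
    intro s hs
    rcases hfs : f s with a | b
    · exact absurd ⟨a, hfs⟩ hs
    · exact ⟨b, rfl⟩
  refine ⟨z.restrict p, z.restrict fun s => ¬ p s, ?_, ?_, iso_par_restrict z p ?_⟩
  · choose g hg using fun s : {s // p s} => s.2
    have hle : ∀ s t, g s ≤ g t ↔ s.1 ≤ t.1 := fun s t => by
      rw [← f.le_iff_le, hg, hg]
      exact Sum.inl_le_inl_iff.symm
    have hlab : ∀ s, x.label (g s) = z.label s.1 := fun s => by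
      rw [← hf, hg]
      rfl
    exact ⟨OrderEmbedding.ofMapLEIff g hle, hlab⟩
  · choose g hg using fun s : {s // ¬ p s} => hn s.1 s.2
    have hle : ∀ s t, g s ≤ g t ↔ s.1 ≤ t.1 := fun s t => by
      rw [← f.le_iff_le, hg, hg]
      exact Sum.inr_le_inr_iff.symm
    have hlab : ∀ s, y.label (g s) = z.label s.1 := fun s => by
      rw [← hf, hg]
      rfl
    exact ⟨OrderEmbedding.ofMapLEIff g hle, hlab⟩
  · rintro s t ⟨a, ha⟩ ht
    obtain ⟨b, hb⟩ := hn t ht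
    rw [← f.le_iff_le, ← f.le_iff_le, ha, hb]
    exact ⟨Sum.not_inl_le_inr, Sum.not_inr_le_inl⟩

/-- A sub-poset of a sequential composition splits sequentially. -/
theorem Embeds.seq {z x y : LPoset A} (h : Embeds z (seq x y)) :
    ∃ z₁ z₂, Embeds z₁ x ∧ Embeds z₂ y ∧ Iso z (LPoset.seq z₁ z₂) := by
  obtain ⟨f, hf⟩ := h
  let p : z.carrier → Prop := fun s => ∃ a : x.carrier, f s = Sum.inlₗ a
  have hn : ∀ s, ¬ p s → ∃ b : y.carrier, f s = Sum.inrₗ b := by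
    intro s hs
    rcases hfs : f s with a | b
    · exact absurd ⟨a, hfs⟩ hs
    · exact ⟨b, rfl⟩
  refine ⟨z.restrict p, z.restrict fun s => ¬ p s, ?_, ?_, iso_seq_restrict z p ?_⟩
  · choose g hg using fun s : {s // p s} => s.2
    have hle : ∀ s t, g s ≤ g t ↔ s.1 ≤ t.1 := fun s t => by
      rw [← f.le_iff_le, hg, hg]
      exact Sum.Lex.inl_le_inl_iff.symm
    have hlab : ∀ s, x.label (g s) = z.label s.1 := fun s => by
      rw [← hf, hg]
      rfl
    exact ⟨OrderEmbedding.ofMapLEIff g hle, hlab⟩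
  · choose g hg using fun s : {s // ¬ p s} => hn s.1 s.2
    have hle : ∀ s t, g s ≤ g t ↔ s.1 ≤ t.1 := fun s t => by
      rw [← f.le_iff_le, hg, hg]
      exact Sum.Lex.inr_le_inr_iff.symm
    have hlab : ∀ s, y.label (g s) = z.label s.1 := fun s => by
      rw [← hf, hg]
      rfl
    exact ⟨OrderEmbedding.ofMapLEIff g hle, hlab⟩
  · rintro s t ⟨a, ha⟩ ht
    obtain ⟨b, hb⟩ := hn t ht
    rw [← f.le_iff_le, ha, hb]
    exact Sum.Lex.inl_le_inr _ _

/-- Base case of the completeness induction: on at most one node there is no order to gain or lose.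
-/
theorem iso_of_subsingleton {x y : LPoset A} (hx : Subsingleton x.carrier)
    (h : Subsumed x y) : Iso x y := by
  obtain ⟨f, hb, hl, -⟩ := h
  have hy : Subsingleton y.carrier := hb.injective.subsingleton
  refine Iso.symm (Iso.of_equiv (Equiv.ofBijective f hb) (fun s t => ?_) hl)
  rw [Subsingleton.elim s t]
  exact iff_of_true le_rfl le_rfl

/-- Subsumption restricts to corresponding sets of nodes. -/
theorem restrict_subsumed {x y : LPoset A} (f : y.carrier → x.carrier)
    (hb : Function.Bijective f) (hl : ∀ s, x.label (f s) = y.label s)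
    (hm : ∀ s t, s ≤ t → f s ≤ f t) (p : x.carrier → Prop) :
    Subsumed (x.restrict p) (y.restrict fun s => p (f s)) := by
  refine ⟨fun s => ⟨f s.1, s.2⟩, ⟨fun s t hst => ?_, fun t => ?_⟩, fun s => hl s.1,
    fun s t hst => hm s.1 t.1 hst⟩
  · exact Subtype.ext (hb.injective (congrArg Subtype.val hst))
  · obtain ⟨s, hs⟩ := hb.surjective t.1
    exact ⟨⟨s, (congrArg p hs).mpr t.2⟩, Subtype.ext hs⟩

theorem Subsumed.trans {x y z : LPoset A} (h : Subsumed x y) (k : Subsumed y z) :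
    Subsumed x z := by
  obtain ⟨f, fb, fl, fm⟩ := h
  obtain ⟨g, gb, gl, gm⟩ := k
  exact ⟨f ∘ g, fb.comp gb, fun s => (fl _).trans (gl s), fun s t hst => fm _ _ (gm _ _ hst)⟩

theorem Iso.subsumed {x y : LPoset A} : Iso x y → Subsumed y x := by
  rintro ⟨e, he⟩
  exact ⟨e, e.bijective, he, fun s t hst => e.monotone hst⟩

theorem Subsumed.card_eq {x y : LPoset A} (h : Subsumed x y) :
    Nat.card x.carrier = Nat.card y.carrier := by
  obtain ⟨f, fb, -⟩ := h
  exact (Nat.card_eq_of_bijective f fb).symm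

theorem card_par (x y : LPoset A) :
    Nat.card (par x y).carrier = Nat.card x.carrier + Nat.card y.carrier := Nat.card_sum

theorem card_seq (x y : LPoset A) :
    Nat.card (seq x y).carrier = Nat.card x.carrier + Nat.card y.carrier :=
  (Nat.card_congr ofLex).trans Nat.card_sum

/-- If a parallel composition is subsumed by `y`, then `y` splits accordingly. -/
theorem Subsumed.of_par_left {x₁ x₂ y : LPoset A} (h : Subsumed (par x₁ x₂) y) :
    ∃ y₁ y₂, Embeds y₁ y ∧ Embeds y₂ y ∧ Iso y (par y₁ y₂) ∧
      Subsumed x₁ y₁ ∧ Subsumed x₂ y₂ := by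
  obtain ⟨f, fb, fl, fm⟩ := h
  -- `f` carries every relation of `y` into `x₁ ∥ x₂`, so nodes of `y` landing on different sides
  -- are incomparable.
  let q : (par x₁ x₂).carrier → Prop := fun s => s.isLeft
  refine ⟨y.restrict fun s => q (f s), y.restrict fun s => ¬ q (f s), restrict_embeds _ _,
    restrict_embeds _ _, iso_par_restrict y _ ?_, ?_, ?_⟩
  · intro s t hs ht
    constructor
    · intro hst
      have := fm _ _ hst
      revert hs ht this
      generalize f s = a, f t = b
      rcases a with a | a <;> rcases b with b | b <;> simp [q]
      exact Sum.not_inl_le_inr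
    · intro hst
      have := fm _ _ hst
      revert hs ht this
      generalize f s = a, f t = b
      rcases a with a | a <;> rcases b with b | b <;> simp [q]
      exact Sum.not_inr_le_inl
  · refine Subsumed.trans (Iso.subsumed ?_) (restrict_subsumed f fb fl fm q)
    refine Iso.symm (Iso.of_equiv (Equiv.ofBijective (fun s => ⟨Sum.inl s, rfl⟩) ⟨?_, ?_⟩) ?_ ?_)
    · intro s t hst
      exact Sum.inl_injective (congrArg Subtype.val hst)
    · rintro ⟨s | s, hs⟩
      · exact ⟨s, rfl⟩
      · exact absurd hs (by simp [q])
    · intro s t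
      exact Sum.inl_le_inl_iff
    · intro s; rfl
  · refine Subsumed.trans (Iso.subsumed ?_) (restrict_subsumed f fb fl fm fun s => ¬ q s)
    refine Iso.symm (Iso.of_equiv
      (Equiv.ofBijective (fun s => ⟨Sum.inr s, by simp [q]⟩) ⟨?_, ?_⟩) ?_ ?_)
    · intro s t hst
      exact Sum.inr_injective (congrArg Subtype.val hst)
    · rintro ⟨s | s, hs⟩
      · exact absurd rfl hs
      · exact ⟨s, rfl⟩
    · intro s t
      exact Sum.inr_le_inr_iff
    · intro s; rfl

/-- If a sequential composition is subsumed by `y`, then `y` splits accordingly. -/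
theorem Subsumed.of_seq_left {x₁ x₂ y : LPoset A} (h : Subsumed (seq x₁ x₂) y) :
    ∃ p : y.carrier → Prop, (∀ s t, p s → ¬ p t → ¬ t ≤ s) ∧
      Subsumed x₁ (y.restrict p) ∧ Subsumed x₂ (y.restrict fun s => ¬ p s) := by
  obtain ⟨f, fb, fl, fm⟩ := h
  let q : (seq x₁ x₂).carrier → Prop := fun s => (ofLex s).isLeft
  -- `y` may have less order than `x₁ · x₂`, so it need not be a sequential composition itself; only
  -- a lower set survives the pullback.
  refine ⟨fun s => q (f s), ?_, ?_, ?_⟩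
  · intro s t (hs : q (f s)) (ht : ¬ q (f t)) hst
    have := fm _ _ hst
    revert hs ht this
    generalize f s = a, f t = b
    rcases a with a | a <;> rcases b with b | b
    · exact fun _ h => (h rfl).elim
    · exact fun _ _ h => absurd h Sum.Lex.not_inr_le_inl
    · exact fun h => absurd h Bool.false_ne_true
    · exact fun h => absurd h Bool.false_ne_true
  · refine Subsumed.trans (Iso.subsumed ?_) (restrict_subsumed f fb fl fm q)
    refine Iso.symm (Iso.of_equiv
      (Equiv.ofBijective (fun s => ⟨Sum.inlₗ s, rfl⟩) ⟨?_, ?_⟩) ?_ ?_)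
    · intro s t hst
      exact Sum.inl_injective (congrArg Subtype.val hst)
    · rintro ⟨s | s, hs⟩
      · exact ⟨s, rfl⟩
      · exact absurd hs Bool.false_ne_true
    · intro s t
      exact Sum.Lex.inl_le_inl_iff
    · intro s; rfl
  · refine Subsumed.trans (Iso.subsumed ?_) (restrict_subsumed f fb fl fm fun s => ¬ q s)
    refine Iso.symm (Iso.of_equiv
      (Equiv.ofBijective (fun s => ⟨Sum.inrₗ s, Bool.false_ne_true⟩) ⟨?_, ?_⟩) ?_ ?_)
    · intro s t hst
      exact Sum.inr_injective (congrArg Subtype.val hst)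
    · rintro ⟨s | s, hs⟩
      · exact absurd rfl hs
      · exact ⟨s, rfl⟩
    · intro s t
      exact Sum.Lex.inr_le_inr_iff
    · intro s; rfl

end LPoset

/-! ### Composition laws, plugging and contexts on labelled posets. -/

namespace LPoset

variable {A : Type u}

instance : IsEmpty (empty A).carrier := inferInstanceAs (IsEmpty Empty)

theorem par_inl_le_inl {x y : LPoset A} (s t : x.carrier) :
    (Sum.inl s : (par x y).carrier) ≤ Sum.inl t ↔ s ≤ t := Sum.inl_le_inl_iff

theorem par_inr_le_inr {x y : LPoset A} (s t : y.carrier) :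
    (Sum.inr s : (par x y).carrier) ≤ Sum.inr t ↔ s ≤ t := Sum.inr_le_inr_iff

theorem seq_inl_le_inl {x y : LPoset A} (s t : x.carrier) :
    (Sum.inlₗ s : (seq x y).carrier) ≤ Sum.inlₗ t ↔ s ≤ t := Sum.Lex.inl_le_inl_iff

theorem seq_inr_le_inr {x y : LPoset A} (s t : y.carrier) :
    (Sum.inrₗ s : (seq x y).carrier) ≤ Sum.inrₗ t ↔ s ≤ t := Sum.Lex.inr_le_inr_iff

theorem par_comm_iso (x y : LPoset A) : Iso (par x y) (par y x) := by
  refine Iso.of_equiv (Equiv.sumComm _ _) ?_ ?_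
  · rintro (s | s) (t | t)
    · exact Sum.inr_le_inr_iff.trans Sum.inl_le_inl_iff.symm
    · exact iff_of_false Sum.not_inr_le_inl Sum.not_inl_le_inr
    · exact iff_of_false Sum.not_inl_le_inr Sum.not_inr_le_inl
    · exact Sum.inl_le_inl_iff.trans Sum.inr_le_inr_iff.symm
  · rintro (s | s) <;> rfl

theorem par_empty_iso (x : LPoset A) : Iso (par x (empty A)) x := by
  refine Iso.of_equiv (Equiv.sumEmpty _ Empty) ?_ ?_
  · rintro (s | ⟨⟨⟩⟩) (t | ⟨⟨⟩⟩)
    exact Sum.inl_le_inl_iff.symm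
  · rintro (s | ⟨⟨⟩⟩)
    rfl

theorem seq_empty_iso (x : LPoset A) : Iso (seq x (empty A)) x := by
  refine Iso.of_equiv (ofLex.trans (Equiv.sumEmpty _ Empty)) ?_ ?_
  · rintro (s | ⟨⟨⟩⟩) (t | ⟨⟨⟩⟩)
    exact Sum.Lex.inl_le_inl_iff.symm
  · rintro (s | ⟨⟨⟩⟩)
    rfl

theorem empty_seq_iso (x : LPoset A) : Iso (seq (empty A) x) x := by
  refine Iso.of_equiv (ofLex.trans (Equiv.emptySum Empty _)) ?_ ?_
  · rintro (⟨⟨⟩⟩ | s) (⟨⟨⟩⟩ | t)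
    exact Sum.Lex.inr_le_inr_iff.symm
  · rintro (⟨⟨⟩⟩ | s)
    rfl

/-- Exchange: `(x ∥ y) · (z ∥ w)` is subsumed by `(x · z) ∥ (y · w)`. -/
theorem exchange_subsumed (x y z w : LPoset A) :
    Subsumed (seq (par x y) (par z w)) (par (seq x z) (seq y w)) := by
  let e : (x.carrier ⊕ y.carrier) ⊕ (z.carrier ⊕ w.carrier) ≃
      (x.carrier ⊕ z.carrier) ⊕ (y.carrier ⊕ w.carrier) := Equiv.sumSumSumComm _ _ _ _
  refine Subsumed.of_equiv (ofLex.trans (e.trans (Equiv.sumCongr toLex toLex))) ?_ ?_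
  · rintro ((s | s) | (s | s)) ((t | t) | (t | t)) h
    · exact Sum.Lex.inl_le_inl_iff.mpr (Sum.inl_le_inl_iff.mpr
        (Sum.Lex.inl_le_inl_iff.mp (Sum.inl_le_inl_iff.mp h)))
    · exact absurd h Sum.not_inl_le_inr
    · exact Sum.Lex.inl_le_inr _ _
    · exact Sum.Lex.inl_le_inr _ _
    · exact absurd h Sum.not_inr_le_inl
    · exact Sum.Lex.inl_le_inl_iff.mpr (Sum.inr_le_inr_iff.mpr
        (Sum.Lex.inl_le_inl_iff.mp (Sum.inr_le_inr_iff.mp h)))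
    · exact Sum.Lex.inl_le_inr _ _
    · exact Sum.Lex.inl_le_inr _ _
    · exact absurd (Sum.inl_le_inl_iff.mp h) Sum.Lex.not_inr_le_inl
    · exact absurd h Sum.not_inl_le_inr
    · exact Sum.Lex.inr_le_inr_iff.mpr (Sum.inl_le_inl_iff.mpr
        (Sum.Lex.inr_le_inr_iff.mp (Sum.inl_le_inl_iff.mp h)))
    · exact absurd h Sum.not_inl_le_inr
    · exact absurd h Sum.not_inr_le_inl
    · exact absurd (Sum.inr_le_inr_iff.mp h) Sum.Lex.not_inr_le_inl
    · exact absurd h Sum.not_inr_le_inl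
    · exact Sum.Lex.inr_le_inr_iff.mpr (Sum.inr_le_inr_iff.mpr
        (Sum.Lex.inr_le_inr_iff.mp (Sum.inr_le_inr_iff.mp h)))
  · rintro ((s | s) | (s | s)) <;> rfl

/-- Relations between a node of `c` and a node of the inserted poset depend on the node of `c`
alone, so fixing `c` and applying `f` inside the gap is monotone. -/
theorem plug_subsumed (c : LPoset (Option A)) {x y : LPoset A} (h : Subsumed x y) :
    Subsumed (plug c x) (plug c y) := by
  obtain ⟨f, fb, fl, fm⟩ := h
  refine ⟨Sum.map id f, ⟨Function.injective_id.sumMap fb.injective,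
    Function.surjective_id.sumMap fb.surjective⟩, ?_, ?_⟩
  · rintro (s | s)
    · rfl
    · exact fl s
  · rintro (s | s) (t | t) h
    · exact h
    · exact h
    · exact h
    · exact fm _ _ h

/-- The inclusion of labelled posets over `A` into those over `A ∪ {*}`. -/
def lift (x : LPoset A) : LPoset (Option A) :=
  ⟨x.carrier, x.finite, x.order, fun s => some (x.label s)⟩

theorem lift_iso {x y : LPoset A} : Iso x y → Iso (lift x) (lift y) := by
  rintro ⟨e, he⟩
  exact ⟨e, fun s => congrArg some (he s)⟩

theorem plug_letter_none_iso (x : LPoset A) : Iso (plug (letter none) x) x := by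
  have : IsEmpty {s : (letter (none : Option A)).carrier //
      (letter (none : Option A)).label s ≠ none} := ⟨fun s => s.2 rfl⟩
  refine Iso.of_equiv (Equiv.emptySum _ _) ?_ ?_
  · rintro (s | s) (t | t)
    · exact this.elim s
    · exact this.elim s
    · exact this.elim t
    · exact Iff.rfl
  · rintro (s | s)
    · exact this.elim s
    · rfl

theorem isContext_par_lift {c : LPoset (Option A)} (hc : c.IsContext) (w : LPoset A) :
    (par c (lift w)).IsContext := by
  obtain ⟨s, hs, hu⟩ := hc
  refine ⟨Sum.inl s, hs, ?_⟩
  rintro (t | t) ht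
  · exact congrArg _ (hu t ht)
  · exact absurd ht (Option.some_ne_none _)

theorem isContext_seq_lift {c : LPoset (Option A)} (hc : c.IsContext) (w : LPoset A) :
    (seq c (lift w)).IsContext := by
  obtain ⟨s, hs, hu⟩ := hc
  refine ⟨Sum.inlₗ s, hs, ?_⟩
  rintro (t | t) ht
  · exact congrArg _ (hu t ht)
  · exact absurd ht (Option.some_ne_none _)

theorem isContext_lift_seq {c : LPoset (Option A)} (hc : c.IsContext) (w : LPoset A) :
    (seq (lift w) c).IsContext := by
  obtain ⟨s, hs, hu⟩ := hc
  refine ⟨Sum.inrₗ s, hs, ?_⟩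
  rintro (t | t) ht
  · exact absurd ht (Option.some_ne_none _)
  · exact congrArg _ (hu t ht)

/-- A layer without the gap can be pulled out of the plugging: the nodes are only regrouped, and
relations with the inserted nodes are read off at the gap `p` on both sides. This and its two
sequential analogues reduce plugging to iterated composition. -/
theorem plug_par_lift_iso {c : LPoset (Option A)} (hc : c.IsContext) (x w : LPoset A) :
    Iso (plug (par c (lift w)) x) (par (plug c x) w) := by
  have hd := isContext_par_lift hc w
  obtain ⟨p, hp, -⟩ := id hc
  refine Iso.symm (Iso.of_equiv (y := plug (par c (lift w)) x)
    (Equiv.ofBijective (fun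
      | .inl (.inl s) => .inl ⟨.inl s.1, s.2⟩
      | .inl (.inr s) => .inr s
      | .inr s => .inl ⟨.inr s, Option.some_ne_none _⟩) ⟨?_, ?_⟩) ?_ ?_)
  · rintro ((⟨s, hs⟩ | s) | s) ((⟨t, ht⟩ | t) | t) h <;> cases h <;> rfl
  · rintro (⟨s | s, hs⟩ | s)
    · exact ⟨.inl (.inl ⟨s, hs⟩), rfl⟩
    · exact ⟨.inr s, rfl⟩
    · exact ⟨.inl (.inr s), rfl⟩
  · rintro ((s | s) | s) ((t | t) | t)
    · exact Sum.inl_le_inl_iff.trans 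
        (par_inl_le_inl (x := plug c x) (y := w) (Sum.inl s) (Sum.inl t)).symm
    · exact (plugLE_inl_inr x hd (p := Sum.inl p) hp _ _).trans (Sum.inl_le_inl_iff.trans
        ((plugLE_inl_inr x hc hp s t).symm.trans 
        (par_inl_le_inl (x := plug c x) (y := w) (Sum.inl s) (Sum.inr t)).symm))
    · exact iff_of_false Sum.not_inl_le_inr Sum.not_inl_le_inr
    · exact (plugLE_inr_inl x hd (p := Sum.inl p) hp _ _).trans (Sum.inl_le_inl_iff.trans
        ((plugLE_inr_inl x hc hp t s).symm.trans 
        (par_inl_le_inl (x := plug c x) (y := w) (Sum.inr s) (Sum.inl t)).symm))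
    · exact (par_inl_le_inl (x := plug c x) (y := w) (Sum.inr s) (Sum.inr t)).symm
    · exact (plugLE_inr_inl x hd (p := Sum.inl p) hp _ _).trans
        (iff_of_false Sum.not_inl_le_inr Sum.not_inl_le_inr)
    · exact iff_of_false Sum.not_inr_le_inl Sum.not_inr_le_inl
    · exact (plugLE_inl_inr x hd (p := Sum.inl p) hp _ _).trans
        (iff_of_false Sum.not_inr_le_inl Sum.not_inr_le_inl)
    · exact Sum.inr_le_inr_iff.trans Sum.inr_le_inr_iff.symm
  · rintro ((s | s) | s) <;> rfl

theorem plug_seq_lift_iso {c : LPoset (Option A)} (hc : c.IsContext) (x w : LPoset A) :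
    Iso (plug (seq c (lift w)) x) (seq (plug c x) w) := by
  have hd := isContext_seq_lift hc w
  obtain ⟨p, hp, -⟩ := id hc
  refine Iso.symm (Iso.of_equiv (x := seq (plug c x) w) (y := plug (seq c (lift w)) x)
    (Equiv.trans ofLex (Equiv.ofBijective (fun
      | .inl (.inl s) => .inl ⟨Sum.inlₗ s.1, s.2⟩
      | .inl (.inr s) => .inr s
      | .inr s => .inl ⟨Sum.inrₗ s, Option.some_ne_none _⟩) ⟨?_, ?_⟩)) ?_ ?_)
  · rintro ((⟨s, hs⟩ | s) | s) ((⟨t, ht⟩ | t) | t) h <;> cases h <;> rfl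
  · rintro (⟨s | s, hs⟩ | s)
    · exact ⟨.inl (.inl ⟨s, hs⟩), rfl⟩
    · exact ⟨.inr s, rfl⟩
    · exact ⟨.inl (.inr s), rfl⟩
  · rintro ((s | s) | s) ((t | t) | t)
    · exact Sum.Lex.inl_le_inl_iff.trans 
        (seq_inl_le_inl (x := plug c x) (y := w) (Sum.inl s) (Sum.inl t)).symm
    · exact (plugLE_inl_inr x hd (p := Sum.inlₗ p) hp _ _).trans (Sum.Lex.inl_le_inl_iff.trans
        ((plugLE_inl_inr x hc hp s t).symm.trans 
        (seq_inl_le_inl (x := plug c x) (y := w) (Sum.inl s) (Sum.inr t)).symm))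
    · exact iff_of_true (Sum.Lex.inl_le_inr _ _) (Sum.Lex.inl_le_inr _ _)
    · exact (plugLE_inr_inl x hd (p := Sum.inlₗ p) hp _ _).trans (Sum.Lex.inl_le_inl_iff.trans
        ((plugLE_inr_inl x hc hp t s).symm.trans 
        (seq_inl_le_inl (x := plug c x) (y := w) (Sum.inr s) (Sum.inl t)).symm))
    · exact (seq_inl_le_inl (x := plug c x) (y := w) (Sum.inr s) (Sum.inr t)).symm
    · exact (plugLE_inr_inl x hd (p := Sum.inlₗ p) hp _ _).trans
        (iff_of_true (Sum.Lex.inl_le_inr _ _) (Sum.Lex.inl_le_inr _ _))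
    · exact iff_of_false Sum.Lex.not_inr_le_inl Sum.Lex.not_inr_le_inl
    · exact (plugLE_inl_inr x hd (p := Sum.inlₗ p) hp _ _).trans
        (iff_of_false Sum.Lex.not_inr_le_inl Sum.Lex.not_inr_le_inl)
    · exact Sum.Lex.inr_le_inr_iff.trans Sum.Lex.inr_le_inr_iff.symm
  · rintro ((s | s) | s) <;> rfl

theorem plug_lift_seq_iso {c : LPoset (Option A)} (hc : c.IsContext) (x w : LPoset A) :
    Iso (plug (seq (lift w) c) x) (seq w (plug c x)) := by
  have hd := isContext_lift_seq hc w
  obtain ⟨p, hp, -⟩ := id hc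
  refine Iso.symm (Iso.of_equiv (x := seq w (plug c x)) (y := plug (seq (lift w) c) x)
    (Equiv.trans ofLex (Equiv.ofBijective (fun
      | .inr (.inl s) => .inl ⟨Sum.inrₗ s.1, s.2⟩
      | .inr (.inr s) => .inr s
      | .inl s => .inl ⟨Sum.inlₗ s, Option.some_ne_none _⟩) ⟨?_, ?_⟩)) ?_ ?_)
  · rintro (s | (⟨s, hs⟩ | s)) (t | (⟨t, ht⟩ | t)) h <;> cases h <;> rfl
  · rintro (⟨s | s, hs⟩ | s)
    · exact ⟨.inl s, rfl⟩
    · exact ⟨.inr (.inl ⟨s, hs⟩), rfl⟩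
    · exact ⟨.inr (.inr s), rfl⟩
  · rintro (s | (s | s)) (t | (t | t))
    · exact Sum.Lex.inl_le_inl_iff.trans Sum.Lex.inl_le_inl_iff.symm
    · exact iff_of_true (Sum.Lex.inl_le_inr _ _) (Sum.Lex.inl_le_inr _ _)
    · exact (plugLE_inl_inr x hd (p := Sum.inrₗ p) hp _ _).trans
        (iff_of_true (Sum.Lex.inl_le_inr _ _) (Sum.Lex.inl_le_inr _ _))
    · exact iff_of_false Sum.Lex.not_inr_le_inl Sum.Lex.not_inr_le_inl
    · exact Sum.Lex.inr_le_inr_iff.trans 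
        (seq_inr_le_inr (x := w) (y := plug c x) (Sum.inl s) (Sum.inl t)).symm
    · exact (plugLE_inl_inr x hd (p := Sum.inrₗ p) hp _ _).trans (Sum.Lex.inr_le_inr_iff.trans
        ((plugLE_inl_inr x hc hp s t).symm.trans 
        (seq_inr_le_inr (x := w) (y := plug c x) (Sum.inl s) (Sum.inr t)).symm))
    · exact (plugLE_inr_inl x hd (p := Sum.inrₗ p) hp _ _).trans
        (iff_of_false Sum.Lex.not_inr_le_inl Sum.Lex.not_inr_le_inl)
    · exact (plugLE_inr_inl x hd (p := Sum.inrₗ p) hp _ _).trans (Sum.Lex.inr_le_inr_iff.trans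
        ((plugLE_inr_inl x hc hp t s).symm.trans 
        (seq_inr_le_inr (x := w) (y := plug c x) (Sum.inr s) (Sum.inl t)).symm))
    · exact (seq_inr_le_inr (x := w) (y := plug c x) (Sum.inr s) (Sum.inr t)).symm
  · rintro (s | (s | s)) <;> rfl

/-- No node is labelled `*`. -/
def StarFree (c : LPoset (Option A)) : Prop := ∀ s, c.label s ≠ none

theorem StarFree.of_iso {c d : LPoset (Option A)} : Iso c d → c.StarFree → d.StarFree := by
  rintro ⟨e, he⟩ h s
  rw [← e.apply_symm_apply s, he]
  exact h _

/-- The single gap lies in one component, which leaves the other star-free; this drives inductions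
over series-parallel contexts. -/
theorem IsContext.par_cases {c d : LPoset (Option A)} (h : (par c d).IsContext) :
    c.IsContext ∧ d.StarFree ∨ d.IsContext ∧ c.StarFree := by
  obtain ⟨s | s, hs, hu⟩ := h
  · exact .inl ⟨⟨s, hs, fun t ht => Sum.inl_injective (hu (.inl t) ht)⟩,
      fun t ht => Sum.inr_ne_inl (hu (.inr t) ht)⟩
  · exact .inr ⟨⟨s, hs, fun t ht => Sum.inr_injective (hu (.inr t) ht)⟩,
      fun t ht => Sum.inl_ne_inr (hu (.inl t) ht)⟩

/-- Being a context ignores the order, and both compositions have the same nodes and labels. -/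
theorem IsContext.seq_cases {c d : LPoset (Option A)} (h : (seq c d).IsContext) :
    c.IsContext ∧ d.StarFree ∨ d.IsContext ∧ c.StarFree :=
  IsContext.par_cases (c := c) (d := d) h

end LPoset

/-! ### Series-parallel pomsets: plugging, sub-posets and decomposition. -/

namespace Pomset

variable {A : Type u}

theorem mk_eq {x y : LPoset A} (h : LPoset.Iso x y) :
    (Quotient.mk _ x : Pomset A) = Quotient.mk _ y := Quotient.sound h

theorem mk_eq_one {x : LPoset A} (h : IsEmpty x.carrier) : (Quotient.mk _ x : Pomset A) = one :=
  mk_eq (LPoset.iso_of_isEmpty h inferInstance)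

theorem par_comm (U V : Pomset A) : par U V = par V U :=
  Quotient.inductionOn₂ U V fun x y => Quotient.sound (LPoset.par_comm_iso x y)

theorem par_one (U : Pomset A) : par U one = U :=
  Quotient.inductionOn U fun x => Quotient.sound (LPoset.par_empty_iso x)

theorem one_par (U : Pomset A) : par one U = U := by rw [par_comm, par_one]

theorem seq_one (U : Pomset A) : seq U one = U :=
  Quotient.inductionOn U fun x => Quotient.sound (LPoset.seq_empty_iso x)

theorem one_seq (U : Pomset A) : seq one U = U :=
  Quotient.inductionOn U fun x => Quotient.sound (LPoset.empty_seq_iso x)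

theorem Subsumed.trans {U V W : Pomset A} : Subsumed U V → Subsumed V W → Subsumed U W :=
  Quotient.inductionOn₃ U V W fun _ _ _ => LPoset.Subsumed.trans

theorem subsumed_refl (U : Pomset A) : Subsumed U U :=
  Quotient.inductionOn U fun x => (LPoset.Iso.refl x).subsumed

theorem exchange_subsumed (U V W X : Pomset A) :
    Subsumed (seq (par U V) (par W X)) (par (seq U W) (seq V X)) :=
  Quotient.inductionOn₂ U V fun x y => Quotient.inductionOn₂ W X fun z w =>
    LPoset.exchange_subsumed x y z w

theorem plug_subsumed (C : Pomset (Option A)) {U V : Pomset A} :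
    Subsumed U V → Subsumed (plug C U) (plug C V) :=
  Quotient.inductionOn₃ C U V fun c _ _ => LPoset.plug_subsumed c

/-- The inclusion of pomsets over `A` into those over `A ∪ {*}`. -/
def lift : Pomset A → Pomset (Option A) := Quotient.map LPoset.lift fun _ _ => LPoset.lift_iso

theorem lift_one : lift (one : Pomset A) = one :=
  Quotient.sound (LPoset.iso_of_isEmpty (x := LPoset.lift (LPoset.empty A))
    (inferInstanceAs (IsEmpty Empty)) inferInstance)

theorem lift_par (U V : Pomset A) : lift (par U V) = par (lift U) (lift V) :=
  Quotient.inductionOn₂ U V fun x y => Quotient.sound (LPoset.Iso.of_equiv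
    (x := LPoset.lift (LPoset.par x y)) (y := LPoset.par (LPoset.lift x) (LPoset.lift y))
    (Equiv.refl _) (fun _ _ => Iff.rfl) (by rintro (s | s) <;> rfl))

theorem lift_seq (U V : Pomset A) : lift (seq U V) = seq (lift U) (lift V) :=
  Quotient.inductionOn₂ U V fun x y => Quotient.sound (LPoset.Iso.of_equiv
    (x := LPoset.lift (LPoset.seq x y)) (y := LPoset.seq (LPoset.lift x) (LPoset.lift y))
    (Equiv.refl _) (fun _ _ => Iff.rfl) (by rintro (s | s) <;> rfl))

theorem IsSP.lift {U : Pomset A} (h : IsSP U) : IsSP (lift U) := by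
  induction h with
  | one => rw [lift_one]; exact .one
  | letter a => exact .letter (some a)
  | par _ _ h₁ h₂ => rw [lift_par]; exact .par h₁ h₂
  | seq _ _ h₁ h₂ => rw [lift_seq]; exact .seq h₁ h₂

/-- No node is labelled `*`. -/
def StarFree : Pomset (Option A) → Prop :=
  Quotient.lift LPoset.StarFree fun _ _ h => propext
    ⟨LPoset.StarFree.of_iso h, LPoset.StarFree.of_iso (LPoset.Iso.symm h)⟩

theorem StarFree.of_par {C D : Pomset (Option A)} :
    StarFree (par C D) → StarFree C ∧ StarFree D :=
  Quotient.inductionOn₂ C D fun _ _ h => ⟨fun s => h (.inl s), fun s => h (.inr s)⟩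

theorem StarFree.of_seq {C D : Pomset (Option A)} :
    StarFree (seq C D) → StarFree C ∧ StarFree D :=
  Quotient.inductionOn₂ C D fun _ _ h => ⟨fun s => h (Sum.inlₗ s), fun s => h (Sum.inrₗ s)⟩

theorem IsContext.par_cases {C D : Pomset (Option A)} :
    IsContext (par C D) → IsContext C ∧ StarFree D ∨ IsContext D ∧ StarFree C :=
  Quotient.inductionOn₂ C D fun _ _ => LPoset.IsContext.par_cases

theorem IsContext.seq_cases {C D : Pomset (Option A)} :
    IsContext (seq C D) → IsContext C ∧ StarFree D ∨ IsContext D ∧ StarFree C :=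
  Quotient.inductionOn₂ C D fun _ _ => LPoset.IsContext.seq_cases

/-- Brings the gapless side of a context into the form that `plug_par_lift`, `plug_seq_lift` and
`plug_lift_seq` require. -/
theorem IsSP.exists_lift {C : Pomset (Option A)} (h : IsSP C) (hs : StarFree C) :
    ∃ W, IsSP W ∧ C = Pomset.lift W := by
  induction h with
  | one => exact ⟨Pomset.one, .one, lift_one.symm⟩
  | letter a =>
    cases a with
    | none => exact absurd rfl (hs ())
    | some a => exact ⟨Pomset.letter a, .letter a, rfl⟩
  | par _ _ h₁ h₂ =>
    obtain ⟨V, hV, rfl⟩ := h₁ hs.of_par.1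
    obtain ⟨W, hW, rfl⟩ := h₂ hs.of_par.2
    exact ⟨_, hV.par hW, (lift_par _ _).symm⟩
  | seq _ _ h₁ h₂ =>
    obtain ⟨V, hV, rfl⟩ := h₁ hs.of_seq.1
    obtain ⟨W, hW, rfl⟩ := h₂ hs.of_seq.2
    exact ⟨_, hV.seq hW, (lift_seq _ _).symm⟩

theorem isContext_letter_none : IsContext (letter (none : Option A)) :=
  ⟨(), rfl, fun _ _ => rfl⟩

theorem plug_letter_none (U : Pomset A) : plug (letter none) U = U :=
  Quotient.inductionOn U fun x => Quotient.sound (LPoset.plug_letter_none_iso x)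

theorem IsContext.par_lift {C : Pomset (Option A)} (W : Pomset A) :
    IsContext C → IsContext (par C (lift W)) :=
  Quotient.inductionOn₂ C W fun _ w hc => LPoset.isContext_par_lift hc w

theorem IsContext.seq_lift {C : Pomset (Option A)} (W : Pomset A) :
    IsContext C → IsContext (seq C (lift W)) :=
  Quotient.inductionOn₂ C W fun _ w hc => LPoset.isContext_seq_lift hc w

theorem IsContext.lift_seq {C : Pomset (Option A)} (W : Pomset A) :
    IsContext C → IsContext (seq (lift W) C) :=
  Quotient.inductionOn₂ C W fun _ w hc => LPoset.isContext_lift_seq hc w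

theorem plug_par_lift {C : Pomset (Option A)} (U W : Pomset A) :
    IsContext C → plug (par C (lift W)) U = par (plug C U) W :=
  Quotient.inductionOn₃ C U W fun _ x w hc => Quotient.sound (LPoset.plug_par_lift_iso hc x w)

theorem plug_seq_lift {C : Pomset (Option A)} (U W : Pomset A) :
    IsContext C → plug (seq C (lift W)) U = seq (plug C U) W :=
  Quotient.inductionOn₃ C U W fun _ x w hc => Quotient.sound (LPoset.plug_seq_lift_iso hc x w)

theorem plug_lift_seq {C : Pomset (Option A)} (U W : Pomset A) :
    IsContext C → plug (seq (lift W) C) U = seq W (plug C U) :=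
  Quotient.inductionOn₃ C U W fun _ x w hc => Quotient.sound (LPoset.plug_lift_seq_iso hc x w)

/-- Plugging a series-parallel pomset into a series-parallel context. -/
theorem IsSP.plug {C : Pomset (Option A)} (h : IsSP C) (hC : IsContext C) {U : Pomset A}
    (hU : IsSP U) : IsSP (plug C U) := by
  induction h with
  | one => obtain ⟨⟨⟩, -⟩ := hC
  | letter a =>
    cases a with
    | none => rwa [plug_letter_none]
    | some a => obtain ⟨_, h, -⟩ := hC; cases h
  | @par C D h₁ h₂ ih₁ ih₂ =>
    rcases hC.par_cases with ⟨hc, hs⟩ | ⟨hc, hs⟩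
    · obtain ⟨W, hW, rfl⟩ := h₂.exists_lift hs
      rw [plug_par_lift _ _ hc]
      exact (ih₁ hc).par hW
    · obtain ⟨W, hW, rfl⟩ := h₁.exists_lift hs
      rw [par_comm, plug_par_lift _ _ hc]
      exact (ih₂ hc).par hW
  | @seq C D h₁ h₂ ih₁ ih₂ =>
    rcases hC.seq_cases with ⟨hc, hs⟩ | ⟨hc, hs⟩
    · obtain ⟨W, hW, rfl⟩ := h₂.exists_lift hs
      rw [plug_seq_lift _ _ hc]
      exact (ih₁ hc).seq hW
    · obtain ⟨W, hW, rfl⟩ := h₁.exists_lift hs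
      rw [plug_lift_seq _ _ hc]
      exact hW.seq (ih₂ hc)

/-- A sub-poset of a series-parallel one is series-parallel. -/
theorem IsSP.of_embeds {U : Pomset A} (h : IsSP U) :
    ∀ x z : LPoset A, Quotient.mk _ x = U → LPoset.Embeds z x → IsSP (Quotient.mk _ z) := by
  induction h with
  | one =>
    intro x z hx hz
    obtain ⟨f, -⟩ := hz.trans_iso (Quotient.exact hx)
    rw [mk_eq_one (Function.isEmpty f)]
    exact .one
  | letter a =>
    intro x z hx hz
    obtain ⟨f, hf⟩ := hz.trans_iso (Quotient.exact hx)
    rcases isEmpty_or_nonempty z.carrier with h | ⟨⟨s⟩⟩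
    · rw [mk_eq_one h]
      exact .one
    · have hz : Subsingleton z.carrier := ⟨fun s t => f.injective rfl⟩
      have e : (Quotient.mk _ z : Pomset A) = Pomset.letter a :=
        mk_eq (LPoset.Iso.of_equiv (y := LPoset.letter a)
          ⟨fun _ => (), fun _ => s, fun t => Subsingleton.elim _ _, fun _ => rfl⟩
          (fun s t => by
            rw [Subsingleton.elim s t]
            exact iff_of_true le_rfl le_rfl) hf)
      rw [e]
      exact .letter a
  | @par U V _ _ ih₁ ih₂ =>
    revert ih₁ ih₂
    refine Quotient.inductionOn₂ U V fun u v ih₁ ih₂ x z hx hz => ?_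
    obtain ⟨z₁, z₂, h₁, h₂, e⟩ := (hz.trans_iso (Quotient.exact hx)).par
    rw [mk_eq e]
    exact .par (ih₁ u z₁ rfl h₁) (ih₂ v z₂ rfl h₂)
  | @seq U V _ _ ih₁ ih₂ =>
    revert ih₁ ih₂
    refine Quotient.inductionOn₂ U V fun u v ih₁ ih₂ x z hx hz => ?_
    obtain ⟨z₁, z₂, h₁, h₂, e⟩ := (hz.trans_iso (Quotient.exact hx)).seq
    rw [mk_eq e]
    exact .seq (ih₁ u z₁ rfl h₁) (ih₂ v z₂ rfl h₂)

/-- A series-parallel pomset with at least two nodes is a composition of two nonempty ones. -/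
theorem IsSP.decompose {U : Pomset A} (h : IsSP U) :
    ∀ x : LPoset A, Quotient.mk _ x = U → Subsingleton x.carrier ∨
      ∃ y z : LPoset A, IsSP (Quotient.mk _ y) ∧ IsSP (Quotient.mk _ z) ∧
        Nonempty y.carrier ∧ Nonempty z.carrier ∧
        (LPoset.Iso x (LPoset.par y z) ∨ LPoset.Iso x (LPoset.seq y z)) := by
  induction h with
  | one =>
    intro x hx
    obtain ⟨e, -⟩ := Quotient.exact hx
    exact .inl ⟨fun s => (e s).elim⟩
  | letter a =>
    intro x hx
    obtain ⟨e, -⟩ := Quotient.exact hx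
    exact .inl ⟨fun s t => e.injective rfl⟩
  | @par U V hU hV ih₁ ih₂ =>
    revert hU hV ih₁ ih₂
    refine Quotient.inductionOn₂ U V fun u v hU hV ih₁ ih₂ x hx => ?_
    -- An empty factor is a unit, so the decomposition of the other factor already serves.
    rcases isEmpty_or_nonempty u.carrier with hu | hu
    · refine ih₂ x (hx.trans ?_)
      rw [mk_eq_one hu]
      exact one_par _
    rcases isEmpty_or_nonempty v.carrier with hv | hv
    · refine ih₁ x (hx.trans ?_)
      rw [mk_eq_one hv]
      exact par_one _
    exact .inr ⟨u, v, hU, hV, hu, hv, .inl (Quotient.exact hx)⟩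
  | @seq U V hU hV ih₁ ih₂ =>
    revert hU hV ih₁ ih₂
    refine Quotient.inductionOn₂ U V fun u v hU hV ih₁ ih₂ x hx => ?_
    rcases isEmpty_or_nonempty u.carrier with hu | hu
    · refine ih₂ x (hx.trans ?_)
      rw [mk_eq_one hu]
      exact one_seq _
    rcases isEmpty_or_nonempty v.carrier with hv | hv
    · refine ih₁ x (hx.trans ?_)
      rw [mk_eq_one hv]
      exact seq_one _
    exact .inr ⟨u, v, hU, hV, hu, hv, .inr (Quotient.exact hx)⟩

end Pomset


/-! ### Completeness of the exchange law for subsumption. -/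

namespace LPoset

variable {A : Type u}

/-- Whatever is subsumed by a sequential composition is a sequential composition. -/
theorem Subsumed.of_seq_right {x y₁ y₂ : LPoset A} (h : Subsumed x (seq y₁ y₂)) :
    ∃ x₁ x₂, Embeds x₁ x ∧ Embeds x₂ x ∧ Iso x (seq x₁ x₂) ∧
      Subsumed x₁ y₁ ∧ Subsumed x₂ y₂ := by
  obtain ⟨f, fb, fl, fm⟩ := h
  let p : x.carrier → Prop := fun s => ∃ a : y₁.carrier, f (Sum.inlₗ a) = s
  have hp : ∀ b : y₂.carrier, ¬ p (f (Sum.inrₗ b)) := by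
    rintro b ⟨a, ha⟩
    exact Sum.inl_ne_inr (fb.injective ha)
  have hn : ∀ s, ¬ p s → ∃ b : y₂.carrier, f (Sum.inrₗ b) = s := by
    intro s hs
    obtain ⟨a | b, rfl⟩ := fb.surjective s
    · exact absurd ⟨a, rfl⟩ hs
    · exact ⟨b, rfl⟩
  refine ⟨x.restrict p, x.restrict fun s => ¬ p s, restrict_embeds _ _, restrict_embeds _ _,
    iso_seq_restrict x p ?_, ?_, ?_⟩
  · rintro s t ⟨a, rfl⟩ ht
    obtain ⟨b, rfl⟩ := hn t ht
    exact fm _ _ (Sum.Lex.inl_le_inr _ _)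
  · refine ⟨fun a => ⟨f (Sum.inlₗ a), a, rfl⟩, ⟨fun a b hab => ?_, ?_⟩, fun a => fl _,
      fun a b hab => fm _ _ (Sum.Lex.inl_le_inl_iff.mpr hab)⟩
    · exact Sum.inl_injective (fb.injective (congrArg Subtype.val hab))
    · rintro ⟨s, a, rfl⟩
      exact ⟨a, rfl⟩
  · refine ⟨fun b => ⟨f (Sum.inrₗ b), hp b⟩, ⟨fun a b hab => ?_, ?_⟩, fun a => fl _,
      fun a b hab => fm _ _ (Sum.Lex.inr_le_inr_iff.mpr hab)⟩
    · exact Sum.inr_injective (fb.injective (congrArg Subtype.val hab))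
    · rintro ⟨s, hs⟩
      obtain ⟨b, rfl⟩ := hn s hs
      exact ⟨b, rfl⟩

/-- Turns one cut of `y₁ ∥ y₂` into separate cuts of `y₁` and `y₂`, which supplies the four pieces
for exchange. -/
theorem restrict_par_iso (x y : LPoset A) (p : (par x y).carrier → Prop) :
    Iso ((par x y).restrict p)
      (par (x.restrict fun s => p (.inl s)) (y.restrict fun s => p (.inr s))) := by
  refine Iso.of_equiv Equiv.subtypeSum ?_ ?_
  · rintro ⟨s | s, hs⟩ ⟨t | t, ht⟩
    · exact (par_inl_le_inl (x := x.restrict fun s => p (.inl s)) ⟨s, hs⟩ ⟨t, ht⟩).trans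
        (par_inl_le_inl (y := y) s t).symm
    · exact iff_of_false Sum.not_inl_le_inr Sum.not_inl_le_inr
    · exact iff_of_false Sum.not_inr_le_inl Sum.not_inr_le_inl
    · exact (par_inr_le_inr (y := y.restrict fun s => p (.inr s)) ⟨s, hs⟩ ⟨t, ht⟩).trans
        (par_inr_le_inr (x := x) s t).symm
  · rintro ⟨s | s, hs⟩ <;> rfl

end LPoset

namespace Pomset

variable {A : Type u}

/-- The least precongruence on series-parallel pomsets that contains the exchange law. -/
inductive ExchLE : Pomset A → Pomset A → Prop
  | refl (U : Pomset A) : ExchLE U U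
  | trans {U V W : Pomset A} : ExchLE U V → ExchLE V W → ExchLE U W
  -- Only `U` and `V'` must be series-parallel: rewriting passes from `U' ∥ V'` through `U ∥ V'` to
  -- `U ∥ V`, and these two serve as the fixed neighbours.
  | par {U U' V V' : Pomset A} : IsSP U → IsSP V' → ExchLE U U' → ExchLE V V' →
      ExchLE (par U V) (par U' V')
  | seq {U U' V V' : Pomset A} : IsSP U → IsSP V' → ExchLE U U' → ExchLE V V' →
      ExchLE (seq U V) (seq U' V')
  | exchange {U V W X : Pomset A} : IsSP U → IsSP V → IsSP W → IsSP X →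
      ExchLE (seq (par U V) (par W X)) (par (seq U W) (seq V X))

/-- Subsumption between series-parallel pomsets is derivable from the exchange law. -/
theorem exchLE_of_subsumed (n : ℕ) : ∀ x y : LPoset A, Nat.card x.carrier = n →
    IsSP (Quotient.mk _ x) → IsSP (Quotient.mk _ y) → LPoset.Subsumed x y →
    ExchLE (Quotient.mk _ x) (Quotient.mk _ y) := by
  induction n using Nat.strong_induction_on with
  | _ n ih =>
  intro x y hn hx hy hxy
  rcases hx.decompose x rfl with hsub | ⟨x₁, x₂, hx₁, hx₂, ne₁, ne₂, hxe⟩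
  · rw [mk_eq (LPoset.iso_of_subsingleton hsub hxy)]
    exact .refl _
  have pos₁ : 0 < Nat.card x₁.carrier := Nat.card_pos
  have pos₂ : 0 < Nat.card x₂.carrier := Nat.card_pos
  rcases hxe with hxe | hxe
  · have hc := hxe.subsumed.card_eq
    rw [LPoset.card_par] at hc
    obtain ⟨y₁, y₂, e₁, e₂, hye, h₁, h₂⟩ :=
      (hxe.subsumed.trans hxy).of_par_left
    rw [mk_eq hxe, mk_eq hye]
    have hy₂ := hy.of_embeds y y₂ rfl e₂
    exact .par hx₁ hy₂ (ih _ (by omega) x₁ y₁ rfl hx₁ (hy.of_embeds y y₁ rfl e₁) h₁)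
      (ih _ (by omega) x₂ y₂ rfl hx₂ hy₂ h₂)
  rcases hy.decompose y rfl with hsub | ⟨y₁, y₂, hy₁, hy₂, me₁, me₂, hye⟩
  · have hsub : Subsingleton x.carrier := by
      obtain ⟨f, fb, -⟩ := hxy
      exact fb.surjective.subsingleton
    rw [mk_eq (LPoset.iso_of_subsingleton hsub hxy)]
    exact .refl _
  have qos₁ : 0 < Nat.card y₁.carrier := Nat.card_pos
  have qos₂ : 0 < Nat.card y₂.carrier := Nat.card_pos
  have hcy := hxy.card_eq
  rcases hye with hye | hye
  · have hc := hxe.subsumed.card_eq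
    have hc' := hye.subsumed.card_eq
    rw [LPoset.card_seq] at hc
    rw [LPoset.card_par] at hc'
    -- `p` marks the nodes of `y₁ ∥ y₂` that lie in `x₁`; it is a lower set.
    obtain ⟨p, hp, h₁, h₂⟩ :=
      ((hxe.subsumed.trans hxy).trans hye.symm.subsumed).of_seq_left
    have k₁ := h₁.trans (LPoset.restrict_par_iso y₁ y₂ p).symm.subsumed
    have k₂ := h₂.trans (LPoset.restrict_par_iso y₁ y₂ fun s => ¬ p s).symm.subsumed
    -- Each `yᵢ` is smaller than `y` because the other factor is nonempty, so the induction
    -- hypothesis will apply to `l₁` and `l₂`.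
    have l₁ := LPoset.seq_restrict_subsumed y₁ (fun s => p (.inl s))
      fun s t hs ht hst => hp (.inl s) (.inl t) hs ht (Sum.inl_le_inl_iff.mpr hst)
    have l₂ := LPoset.seq_restrict_subsumed y₂ (fun s => p (.inr s))
      fun s t hs ht hst => hp (.inr s) (.inr t) hs ht (Sum.inr_le_inr_iff.mpr hst)
    have s₁ := fun q => hy₁.of_embeds y₁ _ rfl (LPoset.restrict_embeds y₁ q)
    have s₂ := fun q => hy₂.of_embeds y₂ _ rfl (LPoset.restrict_embeds y₂ q)
    have c₁ := l₁.card_eq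
    have c₂ := l₂.card_eq
    rw [mk_eq hxe, mk_eq hye]
    exact .trans (.seq hx₁ ((s₁ _).par (s₂ _))
        (ih _ (by omega) x₁ _ rfl hx₁ ((s₁ _).par (s₂ _)) k₁)
        (ih _ (by omega) x₂ _ rfl hx₂ ((s₁ _).par (s₂ _)) k₂))
      (.trans (.exchange (s₁ _) (s₂ _) (s₁ _) (s₂ _))
        (.par ((s₁ _).seq (s₁ _)) hy₂
          (ih _ (by omega) _ y₁ rfl ((s₁ _).seq (s₁ _)) hy₁ l₁)
          (ih _ (by omega) _ y₂ rfl ((s₂ _).seq (s₂ _)) hy₂ l₂)))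
  · have hc' := hye.subsumed.card_eq
    rw [LPoset.card_seq] at hc'
    -- The split `x₁ · x₂` is dropped here, as it need not match that of `y`; `x` is cut anew along
    -- `y₁ · y₂`.
    obtain ⟨z₁, z₂, e₁, e₂, hze, h₁, h₂⟩ := (hxy.trans hye.symm.subsumed).of_seq_right
    have c₁ := h₁.card_eq
    have c₂ := h₂.card_eq
    have hz₁ := hx.of_embeds x z₁ rfl e₁
    rw [mk_eq hze, mk_eq hye]
    exact .seq hz₁ hy₂ (ih _ (by omega) z₁ y₁ rfl hz₁ hy₁ h₁)
      (ih _ (by omega) z₂ y₂ rfl (hx.of_embeds x z₂ rfl e₂) hy₂ h₂)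

theorem SubsumedSP.exchLE {U V : Pomset A} (h : SubsumedSP U V) : ExchLE U V := by
  revert h
  exact Quotient.inductionOn₂ U V fun x y h => exchLE_of_subsumed _ x y rfl h.1 h.2.1 h.2.2

/-! ### From derivations by exchange to membership in the closure. -/

/-- Functions that place a pomset in a series-parallel surrounding, built from the gap outwards. -/
inductive IsSurrounding : (Pomset A → Pomset A) → Prop
  | id : IsSurrounding fun U => U
  | par {F : Pomset A → Pomset A} {W : Pomset A} : IsSurrounding F → IsSP W →
      IsSurrounding fun U => F (par U W)
  | seqLeft {F : Pomset A → Pomset A} {W : Pomset A} : IsSurrounding F → IsSP W →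
      IsSurrounding fun U => F (seq U W)
  | seqRight {F : Pomset A → Pomset A} {W : Pomset A} : IsSurrounding F → IsSP W →
      IsSurrounding fun U => F (seq W U)

/-- `D` accumulates the layers nearest the gap, so each step wraps one more layer around it and
contexts never have to be substituted into contexts. Starting from the bare gap, `F` itself is
plugging into a context. -/
theorem IsSurrounding.exists_context {F : Pomset A → Pomset A} (hF : IsSurrounding F) :
    ∀ D ∈ PCSP A, ∃ C ∈ PCSP A, ∀ U, plug C U = F (plug D U) := by
  induction hF with
  | id => exact fun D hD => ⟨D, hD, fun _ => rfl⟩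
  | @par F W _ hW ih =>
    intro D hD
    obtain ⟨C, hC, h⟩ := ih (.par D (lift W)) ⟨hD.1.par_lift W, hD.2.par hW.lift⟩
    exact ⟨C, hC, fun U => by rw [h, plug_par_lift _ _ hD.1]⟩
  | @seqLeft F W _ hW ih =>
    intro D hD
    obtain ⟨C, hC, h⟩ := ih (.seq D (lift W)) ⟨hD.1.seq_lift W, hD.2.seq hW.lift⟩
    exact ⟨C, hC, fun U => by rw [h, plug_seq_lift _ _ hD.1]⟩
  | @seqRight F W _ hW ih =>
    intro D hD
    obtain ⟨C, hC, h⟩ := ih (.seq (lift W) D) ⟨hD.1.lift_seq W, hW.lift.seq hD.2⟩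
    exact ⟨C, hC, fun U => by rw [h, plug_lift_seq _ _ hD.1]⟩

/-- Exchange hypotheses speak of terms; singleton languages make them act on individual pomsets. -/
theorem IsSP.exists_term {U : Pomset A} (h : IsSP U) : ∃ e : Term A, e.sem = {U} := by
  induction h with
  | one => exact ⟨.one, rfl⟩
  | letter a => exact ⟨.letter a, rfl⟩
  | par _ _ h₁ h₂ =>
    obtain ⟨e, he⟩ := h₁
    obtain ⟨f, hf⟩ := h₂
    exact ⟨.par e f, by rw [Term.sem, he, hf, Set.image2_singleton]⟩
  | seq _ _ h₁ h₂ =>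
    obtain ⟨e, he⟩ := h₁
    obtain ⟨f, hf⟩ := h₂
    exact ⟨.seq e f, by rw [Term.sem, he, hf, Set.image2_singleton]⟩

/-- The surrounding `F` is arbitrary because the congruence rules rewrite in inner positions: the
untouched neighbour becomes a new layer of `F`, and only an exchange step uses the closure rule. -/
theorem ExchLE.inClosure {L : Set (Pomset A)} {U V : Pomset A} (h : ExchLE U V) :
    ∀ F, IsSurrounding F → InClosure (exch A) L (F V) → InClosure (exch A) L (F U) := by
  induction h with
  | refl => exact fun _ _ h => h
  | trans _ _ ih₁ ih₂ => exact fun F hF h => ih₁ F hF (ih₂ F hF h)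
  | @par U U' V V' hU hV _ _ ih₁ ih₂ =>
    intro F hF h
    have h := ih₁ _ (hF.par hV) h
    rw [par_comm] at h ⊢
    exact ih₂ _ (hF.par hU) h
  | seq hU hV _ _ ih₁ ih₂ =>
    exact fun F hF h => ih₂ _ (hF.seqRight hU) (ih₁ _ (hF.seqLeft hV) h)
  | @exchange U V W X hU hV hW hX =>
    intro F hF h
    obtain ⟨C, hC, hCF⟩ := hF.exists_context (letter none)
      (And.intro isContext_letter_none (.letter none))
    simp only [plug_letter_none] at hCF
    obtain ⟨e, he⟩ := hU.exists_term
    obtain ⟨f, hf⟩ := hV.exists_term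
    obtain ⟨g, hg⟩ := hW.exists_term
    obtain ⟨k, hk⟩ := hX.exists_term
    have hmem : ⟨.seq (.par e f) (.par g k), .par (.seq e g) (.seq f k)⟩ ∈ exch A :=
      ⟨e, f, g, k, rfl⟩
    refine InClosure.step hmem hC ?_ ?_
    · simpa [plugLang, Term.sem, he, hf, hg, hk, hCF] using h
    · simp [plugLang, Term.sem, he, hf, hg, hk, hCF]

end Pomset

/-! ### Soundness: the closure lies below the language. -/

theorem isSP_of_mem_langPow {A : Type u} {L : Set (Pomset A)} (hL : L ⊆ SP A) (n : ℕ) :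
    langPow L n ⊆ SP A := by
  induction n with
  | zero => rintro _ rfl; exact .one
  | succ n ih => rintro _ ⟨U, hU, V, hV, rfl⟩; exact .seq (ih hU) (hL hV)

theorem isSP_of_mem_sem {A : Type u} {e : Term A} {U : Pomset A} (h : U ∈ e.sem) : U.IsSP := by
  induction e generalizing U with
  | zero => exact h.elim
  | one => cases h; exact .one
  | letter a => cases h; exact .letter a
  | add e f he hf => exact h.elim he hf
  | seq e f he hf => obtain ⟨V, hV, W, hW, rfl⟩ := h; exact .seq (he hV) (hf hW)
  | par e f he hf => obtain ⟨V, hV, W, hW, rfl⟩ := h; exact .par (he hV) (hf hW)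
  | star e he =>
    obtain ⟨n, hn⟩ := Set.mem_iUnion.mp h
    exact isSP_of_mem_langPow (fun _ => he) n hn

/-- The closure under exchange stays below the language it starts from. -/
theorem InClosure.exists_subsumedSP {A : Type u} {L : Set (Pomset A)} (hL : L ⊆ SP A)
    {U : Pomset A} (h : InClosure (exch A) L U) : ∃ V ∈ L, Pomset.SubsumedSP U V := by
  induction h with
  | @base U hU => exact ⟨U, hU, hL hU, hL hU, Pomset.subsumed_refl U⟩
  | @step k C hk hC _ U hU ih =>
    obtain ⟨e, f, g, h, rfl⟩ := hk
    obtain ⟨_, ⟨_, ⟨u, hu, v, hv, rfl⟩, _, ⟨w, hw, x, hx, rfl⟩, rfl⟩, rfl⟩ := hU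
    -- The same four pomsets, recombined as on the larger side of exchange, give an element to which
    -- the induction hypothesis applies.
    obtain ⟨V, hVL, hsp, hV, hs⟩ := ih (C.plug (.par (.seq u w) (.seq v x)))
      ⟨_, ⟨_, ⟨u, hu, w, hw, rfl⟩, _, ⟨v, hv, x, hx, rfl⟩, rfl⟩, rfl⟩
    have hX := ((isSP_of_mem_sem hu).par (isSP_of_mem_sem hv)).seq
      ((isSP_of_mem_sem hw).par (isSP_of_mem_sem hx))
    exact ⟨V, hVL, hC.2.plug hC.1 hX, hV,
      (Pomset.plug_subsumed C (Pomset.exchange_subsumed u v w x)).trans hs⟩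

end CKA

theorem mainTheorem7 {A : Type*} (L : Set (CKA.Pomset A)) (hL : L ⊆ CKA.SP A) :
    (∀ U ∈ CKA.SP A,
      (U ∈ CKA.hypClosure (CKA.exch A) L ↔ ∃ V ∈ L, CKA.Pomset.SubsumedSP U V)) ∧
    CKA.hypClosure (CKA.exch A) L = {U | ∃ V ∈ L, CKA.Pomset.SubsumedSP U V} := by
  -- No assumption `U ∈ SP` is needed: either side implies it, as `L ⊆ SP`. Hence both claims follow
  -- at once.
  have h : ∀ U, U ∈ CKA.hypClosure (CKA.exch A) L ↔ ∃ V ∈ L, CKA.Pomset.SubsumedSP U V :=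
    fun U => ⟨CKA.InClosure.exists_subsumedSP hL, fun ⟨_, hV, hs⟩ =>
      hs.exchLE.inClosure _ .id (.base hV)⟩
  exact ⟨fun U _ => h U, Set.ext h⟩
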